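/- **Setting.** A region $O$ is an open bounded interval of the light ray $\mathbb R$ (chiral case) or a double cone in two-dimensional Minkowski space (two-dimensional case). "Left of" means "in the past of" in the chiral case and "in the left component of the causal complement of" in the two-dimensional case. Let $\mathcal A$ be an isotonous Haag dual net ($\mathcal A(O)=\mathcal A(O')'$, where $O'$ is the causal complement of $O$) of von Neumann algebras on a Hilbert space, whose local algebras $\mathcal A(O)$ are type III factors in which every nonzero projection is of the form $ss^*$ with $s\in\mathcal A(O)$, $s^*s=1$ (automatic for type III factors on separable Hilbert spaces). Write $\mathcal A$ also for the C*-algebra generated by all $\mathcal A(O)$. A DHR endomorphism $\rho$ is a unital $*$-endomorphism of $\mathcal A$ that is localized in some region $O$ (acts trivially on $\mathcal A(O')$), such that for every region $\widehat O$ there is a unitary $u\in\mathcal A$ with $\mathrm{Ad}_u\rho=u\rho(\cdot)u^*$ localized in $\widehat O$. Let $\mathrm{Hom}(\rho,\sigma)=\{t\in\mathcal A: t\rho(a)=\sigma(a)t\ \forall a\in\mathcal A\}$. The braiding is $$\varepsilon_{\rho,\sigma}=\sigma(u_\rho^*)\,u_\sigma^*\,u_\rho\,\rho(u_\sigma),$$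 where $u_\rho,u_\sigma\in\mathcal A$ are any unitaries such that $\mathrm{Ad}_{u_\rho}\rho$ and $\mathrm{Ad}_{u_\sigma}\sigma$ are localized in regions $O_\rho$, $O_\sigma$ with $O_\sigma$ left of $O_\rho$ (the result does not depend on this choice). Let $(\theta,w,x)$ be a Q-system of DHR endomorphisms: $\theta$ is a DHR endomorphism of finite dimension, $w\in\mathrm{Hom}(\mathrm{id},\theta)$, $x\in\mathrm{Hom}(\theta,\theta^2)$, with $$w^*x=\theta(w^*)x=1,\quad xx=\theta(x)x,\quad xx^*=\theta(x^*)x,\quad w^*w=x^*x=d\cdot 1,\quad d=\sqrt{\dim\theta}.$$ Here $\dim\theta$ is the infimum of the numbers $\delta$ for which there are a DHR endomorphism $\overline\theta$ and $r\in\mathrm{Hom}(\mathrm{id},\overline\theta\theta)$, $\overline r\in\mathrm{Hom}(\mathrm{id},\theta\overline\theta)$ with $\overline r^*\theta(r)=1=r^*\overline\theta(\overline r)$ and $r^*r=\overline r^*\overline r=\delta\cdot 1$. The multiplicity of $\mathrm{id}$ in $\theta$ is arbitrary. The associated extension $\iota:\mathcal A\to\mathcal B$ is the $*$-algebra generated by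 $\iota(\mathcal A)$ and one element $v$ with the relations $$v^*=\iota(w^*x^*)v,\quad vv=\iota(x)v,\quad \iota(w^*)v=1,\quad v\,\iota(a)=\iota(\theta(a))v\quad(a\in\mathcal A);$$ each of its elements is $\iota(a)v$ for a unique $a\in\mathcal A$. Its local algebras are $\mathcal B(O)=\iota(\mathcal A(O))\,\iota(u)v$, where $u\in\mathcal A$ is unitary and $\mathrm{Ad}_u\theta$ is localized in $O$. Let $p\in\mathrm{Hom}(\theta,\theta)$ be a projection with $$pw=w,\qquad p\,\theta(p)\,x=p\,x\,p=\theta(p)\,x\,p,$$ and let $\mathcal B_1$ be the intermediate extension $\mathcal A\subset\mathcal B_1\subset\mathcal B$ given by $p$: $\mathcal B_1(O)=\iota(\mathcal A(O))\,\iota(s^*)v$, where $s\in\mathcal A$, $s^*s=1$, $ss^*=p$, and $s^*\theta(\cdot)s$ is localized in $O$. A net $\mathcal B_1$ is left-local with respect to a net $\mathcal B_2$ in the same algebra if $\mathcal B_1(O_1)$ commutes with $\mathcal B_2(O_2)$ whenever $O_1$ is left of $O_2$; it is right-local with respect to $\mathcal B_2$ if $\mathcal B_2$ is left-local with respect to $\mathcal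 B_1$. **Lemma.** $\mathcal B$ is left-local with respect to $\mathcal B_1$ if and only if $$\theta(p)\,x=\varepsilon_{\theta,\theta}\,p\,x .$$ $\mathcal B$ is right-local with respect to $\mathcal B_1$ if and only if $$\theta(p)\,x=\varepsilon_{\theta,\theta}^*\,p\,x .$$ -/

import Mathlib

open scoped ENNReal

namespace AQFT

noncomputable section

/-! ### Regions

A point is given by its light-ray coordinates. For `n = 1` (the chiral case) this is a point of the
light ray `ℝ`. For `n = 2` (two-dimensional Minkowski space) the coordinates of the point `(t, x)`
are `(x + t, x - t)`; then `(t₁, x₁)` is in the spacelike left of `(t₂, x₂)`, that is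
`x₂ - x₁ > |t₂ - t₁|`, if and only if both coordinates of the first point are strictly smaller. -/

/-- The bounded open region `{ξ | ∀ i, lo i < ξ i < hi i}`: an open interval of the light ray for
`n = 1`, a double cone for `n = 2`. -/
structure Region (n : ℕ) where
  lo : Fin n → ℝ
  hi : Fin n → ℝ
  lt : ∀ i, lo i < hi i

namespace Region

variable {n : ℕ}

/-- Inclusion of regions. -/
def Sub (O₁ O₂ : Region n) : Prop := ∀ i, O₂.lo i ≤ O₁.lo i ∧ O₁.hi i ≤ O₂.hi i

/-- `O₁` is contained in the left component of the causal complement of `O₂`: every coordinate of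
every point of `O₁` is smaller than that of every point of `O₂`. In the chiral case `O₁` is the
interval in the past. -/
def LeftOf (O₁ O₂ : Region n) : Prop := ∀ i, O₁.hi i ≤ O₂.lo i

/-- `O₁` is contained in the causal complement of `O₂`. -/
def Spacelike (O₁ O₂ : Region n) : Prop := O₁.LeftOf O₂ ∨ O₂.LeftOf O₁

end Region

/-! ### Haag dual nets of type III factors -/

section Net

variable {H : Type*} [NormedAddCommGroup H] [InnerProductSpace ℂ H] [CompleteSpace H]

/-- A von Neumann algebra with trivial centre, different from the scalars, in which every nonzero
projection is equivalent to the identity. On a separable Hilbert space these are precisely the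
type III factors. -/
structure IsTypeIIIFactor (M : VonNeumannAlgebra H) : Prop where
  factor : ∀ a ∈ M, a ∈ M.commutant → ∃ c : ℂ, a = c • (1 : H →L[ℂ] H)
  proper : ∃ e ∈ M, IsStarProjection e ∧ e ≠ 0 ∧ e ≠ 1
  equiv_one : ∀ e ∈ M, IsStarProjection e → e ≠ 0 → ∃ s ∈ M, star s * s = 1 ∧ s * star s = e

end Net

/-- A Haag dual net of von Neumann algebras `O ↦ 𝒜(O)` on the Hilbert space `H`, with type III
factors as local algebras. Haag duality `𝒜(O) = 𝒜(O')'` contains locality. -/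
structure Net (n : ℕ) (H : Type*) [NormedAddCommGroup H] [InnerProductSpace ℂ H]
    [CompleteSpace H] where
  alg : Region n → VonNeumannAlgebra H
  isotony : ∀ O₁ O₂ : Region n, O₁.Sub O₂ → (alg O₁ : Set (H →L[ℂ] H)) ⊆ alg O₂
  haag_duality : ∀ O : Region n,
    (alg O : Set (H →L[ℂ] H)) =
      Set.centralizer {a : H →L[ℂ] H | ∃ O₁ : Region n, O₁.Spacelike O ∧ a ∈ alg O₁}
  typeIII : ∀ O : Region n, IsTypeIIIFactor (alg O)

variable {n : ℕ} {H : Type*} [NormedAddCommGroup H] [InnerProductSpace ℂ H] [CompleteSpace H]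

namespace Net

/-- The quasi-local algebra `𝒜`: the C*-algebra generated by all local algebras. -/
def quasi (A : Net n H) : StarSubalgebra ℂ (H →L[ℂ] H) :=
  (⨆ O : Region n, (A.alg O).toStarSubalgebra).topologicalClosure

/-- `𝒜(O)` as a subset of the quasi-local algebra. -/
def loc (A : Net n H) (O : Region n) : Set A.quasi := {a | (a : H →L[ℂ] H) ∈ A.alg O}

/-- A map `f` of the quasi-local algebra into itself is localized in `O` if it acts trivially on
`𝒜(O')`. -/
def LocalizedIn (A : Net n H) (f : A.quasi → A.quasi) (O : Region n) : Prop :=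
  ∀ O₁ : Region n, O₁.Spacelike O → ∀ a ∈ A.loc O₁, f a = a

end Net

/-! ### DHR endomorphisms -/

/-- DHR endomorphisms: unital `*`-endomorphisms of the quasi-local algebra that are localized in
some region and whose localization can be moved to any other region by a unitary charge
transporter. -/
structure DHREnd (A : Net n H) where
  toHom : A.quasi →⋆ₐ[ℂ] A.quasi
  localized : ∃ O : Region n, A.LocalizedIn toHom O
  transportable : ∀ O : Region n, ∃ u ∈ unitary A.quasi,
    A.LocalizedIn (fun a => u * toHom a * star u) O

namespace DHREnd

variable {A : Net n H}

instance : CoeFun (DHREnd A) (fun _ => A.quasi → A.quasi) := ⟨fun ρ => ρ.toHom⟩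

/-- `u` is a unitary charge transporter taking `ρ` to an endomorphism `Ad_u ρ` localized in `O`. -/
def Transports (ρ : DHREnd A) (u : A.quasi) (O : Region n) : Prop :=
  u ∈ unitary A.quasi ∧ A.LocalizedIn (fun a => u * ρ a * star u) O

/-- The unit cube with lower corner `(c, …, c)`. -/
def unitRegion (n : ℕ) (c : ℝ) : Region n where
  lo := fun _ => c
  hi := fun _ => c + 1
  lt := fun _ => by linarith

theorem exists_auxiliaries (ρ σ : DHREnd A) : ∃ q : A.quasi × A.quasi,
    ∃ Oρ Oσ : Region n, Oσ.LeftOf Oρ ∧ ρ.Transports q.1 Oρ ∧ σ.Transports q.2 Oσ := by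
  obtain ⟨u, hu⟩ := ρ.transportable (unitRegion n 1)
  obtain ⟨u', hu'⟩ := σ.transportable (unitRegion n 0)
  exact ⟨(u, u'), unitRegion n 1, unitRegion n 0,
    fun _ => by simp [unitRegion], hu, hu'⟩

/-- The statistics operator (braiding) `ε_{ρ,σ} = σ(u_ρ*) u_σ* u_ρ ρ(u_σ)`, where `u_ρ`, `u_σ` are
unitaries such that `Ad_{u_ρ} ρ` and `Ad_{u_σ} σ` are localized in regions `O_ρ`, `O_σ` with
`O_σ` to the left of `O_ρ`. It does not depend on the choice of these auxiliary data. -/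
def braiding (ρ σ : DHREnd A) : A.quasi :=
  let uρ := (exists_auxiliaries ρ σ).choose.1
  let uσ := (exists_auxiliaries ρ σ).choose.2
  σ (star uρ) * star uσ * uρ * ρ uσ

/-- `ρbar` is conjugate to `ρ` through intertwiners `r : id → ρbar ρ` and `rbar : id → ρ ρbar` that
solve the conjugacy relations with the normalization `r* r = rbar* rbar = d • 1`. -/
def IsConjugate (ρ ρbar : DHREnd A) (r rbar : A.quasi) (d : ℝ) : Prop :=
  (∀ a, r * a = ρbar (ρ a) * r) ∧ (∀ a, rbar * a = ρ (ρbar a) * rbar) ∧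
  star rbar * ρ r = 1 ∧ star r * ρbar rbar = 1 ∧
  star r * r = (d : ℂ) • (1 : A.quasi) ∧ star rbar * rbar = (d : ℂ) • (1 : A.quasi)

/-- The dimension of a DHR endomorphism: the infimum of the normalizations `d` of solutions of the
conjugacy relations, and `∞` if there is no conjugate. -/
def dim (ρ : DHREnd A) : ℝ≥0∞ :=
  sInf {δ | ∃ (ρbar : DHREnd A) (r rbar : A.quasi) (d : ℝ),
    ρ.IsConjugate ρbar r rbar d ∧ δ = ENNReal.ofReal d}

end DHREnd

/-! ### Q-systems and the associated extension -/

/-- A Q-system `(θ, w, x)` of dimension `d = √(dim θ)` in the category of DHR endomorphisms of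
finite dimension. The multiplicity of `id` in `θ` is arbitrary. -/
structure QSystem (A : Net n H) where
  θ : DHREnd A
  w : A.quasi
  x : A.quasi
  d : ℝ
  w_intertwines : ∀ a, w * a = θ a * w
  x_intertwines : ∀ a, x * θ a = θ (θ a) * x
  unit_left : star w * x = 1
  unit_right : θ (star w) * x = 1
  assoc : x * x = θ x * x
  frobenius : x * star x = θ (star x) * x
  w_norm : star w * w = (d : ℂ) • (1 : A.quasi)
  x_norm : star x * x = (d : ℂ) • (1 : A.quasi)
  d_nonneg : 0 ≤ d
  standard : θ.dim = ENNReal.ofReal (d ^ 2)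

/-- The extension `ℬ` of `𝒜` determined by a Q-system. Every element is uniquely of the form
`ι(a) v` with `a ∈ 𝒜`; `⟨a⟩` is this element. The algebraic operations below are the ones forced by
the relations `v* = ι(w* x*) v`, `v v = ι(x) v`, `ι(w*) v = 1`, `v ι(a) = ι(θ(a)) v`. -/
@[ext]
structure Ext {A : Net n H} (Q : QSystem A) where
  coeff : A.quasi

namespace Ext

variable {A : Net n H} {Q : QSystem A}

/-- The bijection `ι(a) v ↦ a`. -/
def equiv (Q : QSystem A) : Ext Q ≃ A.quasi := ⟨coeff, mk, fun _ => rfl, fun _ => rfl⟩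

instance : AddCommGroup (Ext Q) := (equiv Q).addCommGroup

instance : Module ℂ (Ext Q) := (equiv Q).module ℂ

/-- `ι(a)v · ι(b)v = ι(a θ(b) x) v`. -/
instance : Mul (Ext Q) := ⟨fun a b => ⟨a.coeff * Q.θ b.coeff * Q.x⟩⟩

/-- `1 = ι(w*) v`. -/
instance : One (Ext Q) := ⟨⟨star Q.w⟩⟩

/-- `(ι(a) v)* = ι(w* x* θ(a*)) v`. -/
instance : Star (Ext Q) := ⟨fun a => ⟨star Q.w * star Q.x * Q.θ (star a.coeff)⟩⟩

@[simp] theorem coeff_zero : (0 : Ext Q).coeff = 0 := rfl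
@[simp] theorem coeff_add (a b : Ext Q) : (a + b).coeff = a.coeff + b.coeff := rfl
@[simp] theorem coeff_smul (c : ℂ) (a : Ext Q) : (c • a).coeff = c • a.coeff := rfl
@[simp] theorem coeff_one : (1 : Ext Q).coeff = star Q.w := rfl
@[simp] theorem coeff_mul (a b : Ext Q) : (a * b).coeff = a.coeff * Q.θ b.coeff * Q.x := rfl
@[simp] theorem coeff_star (a : Ext Q) :
    (star a).coeff = star Q.w * star Q.x * Q.θ (star a.coeff) := rfl

theorem w_star_mul (Q : QSystem A) (a : A.quasi) : star Q.w * Q.θ a = a * star Q.w := by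
  have h := congrArg star (Q.w_intertwines (star a))
  simpa [← map_star] using h.symm

theorem x_star_mul (Q : QSystem A) (a : A.quasi) :
    star Q.x * Q.θ (Q.θ a) = Q.θ a * star Q.x := by
  have h := congrArg star (Q.x_intertwines (star a))
  simpa [← map_star] using h.symm

theorem frobenius_star (Q : QSystem A) : star Q.x * Q.θ Q.x = Q.x * star Q.x := by
  have h := congrArg star Q.frobenius
  simpa [← map_star] using h.symm

theorem assoc_star (Q : QSystem A) : star Q.x * Q.θ (star Q.x) = star Q.x * star Q.x := by
  have h := congrArg star Q.assoc
  simpa [← map_star] using h.symm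

theorem unit_right_star (Q : QSystem A) : star Q.x * Q.θ Q.w = 1 := by
  have h := congrArg star Q.unit_right
  simpa [← map_star] using h

instance : Ring (Ext Q) :=
  { (inferInstance : AddCommGroup (Ext Q)) with
    mul := (· * ·)
    one := 1
    left_distrib := fun a b c => by ext1; simp [mul_add, add_mul]
    right_distrib := fun a b c => by ext1; simp [add_mul]
    zero_mul := fun a => by ext1; simp
    mul_zero := fun a => by ext1; simp
    mul_assoc := fun a b c => by
      ext1
      simp only [coeff_mul, map_mul, mul_assoc]
      rw [← Q.assoc, ← mul_assoc Q.x, Q.x_intertwines, mul_assoc]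
    one_mul := fun a => by
      ext1
      simp only [coeff_mul, coeff_one]
      rw [w_star_mul, mul_assoc, Q.unit_left, mul_one]
    mul_one := fun a => by
      ext1
      simp only [coeff_mul, coeff_one]
      rw [mul_assoc, Q.unit_right, mul_one] }

instance : Algebra ℂ (Ext Q) :=
  Algebra.ofModule (fun c a b => by ext1; simp) (fun c a b => by ext1; simp)

instance : StarRing (Ext Q) where
  star_involutive a := by
    ext1
    simp only [coeff_star, star_mul, star_star, map_mul, ← map_star, mul_assoc]
    rw [← mul_assoc (star Q.x), x_star_mul, ← mul_assoc (star Q.w), ← mul_assoc (star Q.w),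
      w_star_mul, mul_assoc, mul_assoc, ← mul_assoc (star Q.x), frobenius_star, mul_assoc,
      unit_right_star, mul_one, Q.unit_left, mul_one]
  star_mul a b := by
    ext1
    simp only [coeff_star, coeff_mul, star_mul, map_mul, ← map_star, mul_assoc]
    rw [← Q.x_intertwines, ← mul_assoc (Q.θ (star Q.x)) Q.x, ← Q.frobenius, mul_assoc Q.x,
      ← mul_assoc (Q.θ (star Q.w)), Q.unit_right, one_mul,
      ← mul_assoc (star Q.x) (Q.θ (star Q.x)), assoc_star, mul_assoc,
      ← mul_assoc (star Q.x) (Q.θ (Q.θ (star b.coeff))), x_star_mul, mul_assoc]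
  star_add a b := by ext1; simp [mul_add]

instance : StarModule ℂ (Ext Q) := ⟨fun c a => by ext1; simp⟩

/-- The generator `v`. -/
def v (Q : QSystem A) : Ext Q := ⟨1⟩

/-- The embedding `ι : 𝒜 → ℬ`, `ι(a) = ι(a w*) v`. -/
def ι (Q : QSystem A) : A.quasi →⋆ₐ[ℂ] Ext Q where
  toFun a := ⟨a * star Q.w⟩
  map_one' := by ext1; simp
  map_mul' a b := by
    ext1
    simp only [coeff_mul, map_mul, mul_assoc]
    rw [Q.unit_right, mul_one, w_star_mul]
  map_zero' := by ext1; simp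
  map_add' a b := by ext1; simp [add_mul]
  commutes' c := by
    ext1
    simp [Algebra.algebraMap_eq_smul_one]
  map_star' a := by
    ext1
    simp only [coeff_star, star_mul, star_star, map_mul]
    rw [mul_assoc, ← mul_assoc (star Q.x), unit_right_star, one_mul, w_star_mul]

/-- The defining relations of the extension. -/
theorem relations (Q : QSystem A) :
    star (v Q) = ι Q (star Q.w * star Q.x) * v Q ∧ v Q * v Q = ι Q Q.x * v Q ∧
    ι Q (star Q.w) * v Q = 1 ∧ ∀ a, v Q * ι Q a = ι Q (Q.θ a) * v Q := by
  refine ⟨?_, ?_, ?_, fun a => ?_⟩ <;> ext1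
  · simp [ι, v, mul_assoc, Q.unit_left]
  · simp [ι, v, mul_assoc, Q.unit_left]
  · simp [ι, v, mul_assoc, Q.unit_left]
  · simp [ι, v, mul_assoc, Q.unit_left, Q.unit_right]

/-- Every element of the extension is of the form `ι(a) v` with a unique `a`. -/
theorem eq_ι_mul_v (b : Ext Q) : b = ι Q b.coeff * v Q := by
  ext1
  simp [ι, v, mul_assoc, Q.unit_left]

/-- The local algebras `ℬ(O) = ι(𝒜(O)) · ι(u) v`, where `u` is a unitary such that `Ad_u θ` is
localized in `O`. -/
def net (Q : QSystem A) (O : Region n) : Set (Ext Q) :=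
  {b | ∃ a ∈ A.loc O, ∃ u, Q.θ.Transports u O ∧ b = ι Q a * (ι Q u * v Q)}

/-- The local algebras `ℬ_p(O) = ι(𝒜(O)) · ι(s*) v` of the intermediate extension given by the
projection `p`, where `s` is an isometry such that `p = s s*` and `s* θ(·) s` is localized in
`O`. -/
def intermediateNet (Q : QSystem A) (p : A.quasi) (O : Region n) : Set (Ext Q) :=
  {b | ∃ a ∈ A.loc O, ∃ s : A.quasi, star s * s = 1 ∧ s * star s = p ∧
    A.LocalizedIn (fun c => star s * Q.θ c * s) O ∧ b = ι Q a * (ι Q (star s) * v Q)}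

end Ext

/-- `p` is a projection in `Hom(θ,θ)` with `p w = w` and `p θ(p) x = p x p = θ(p) x p`. -/
structure QSystem.IsIntermediate {A : Net n H} (Q : QSystem A) (p : A.quasi) : Prop where
  projection : IsStarProjection p
  intertwines : ∀ a, p * Q.θ a = Q.θ a * p
  unit : p * Q.w = Q.w
  mul_eq : p * Q.θ p * Q.x = p * Q.x * p
  eq_mul : p * Q.x * p = Q.θ p * Q.x * p

/-- The net `B₁` is left-local with respect to `B₂`: `B₁(O₁)` commutes with `B₂(O₂)` whenever `O₁`
is in the left causal complement of `O₂`. -/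
def LeftLocal {R : Type*} [Mul R] (B₁ B₂ : Region n → Set R) : Prop :=
  ∀ O₁ O₂ : Region n, O₁.LeftOf O₂ → ∀ b₁ ∈ B₁ O₁, ∀ b₂ ∈ B₂ O₂, Commute b₁ b₂

/-- The net `B₁` is right-local with respect to `B₂` if `B₂` is left-local with respect to `B₁`. -/
def RightLocal {R : Type*} [Mul R] (B₁ B₂ : Region n → Set R) : Prop := LeftLocal B₂ B₁

end

end AQFT

/-! Take `ι(a s*) v` in `ℬ_p(O₁)` and `ι(b u) v` in `ℬ(O₂)` with `O₁`, `O₂` spacelike. The factors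
`a`, `b` pass through the foreign coefficients, because `s*` and `u` turn `θ` into the identity
outside their regions. What remains is the exchange relation `u θ(s*) x = s* θ(u) x`, equivalent to
`θ(p) x = θ(s) u* s* θ(u) x`. Let `r` be a unitary transporting `θ` to `O₁`. By Haag duality `r s`
lies in `𝒜(O₁)`, so `θ(r s) u* = u* r s`, and the right side becomes `θ(r*) u* r θ(u) p x`. Its
prefactor is `ε` if `O₂` is left of `O₁` and `ε*` in the opposite order (`exchange_iff`). Since the
resulting identity does not mention the regions, one pair of regions decides all of them
(`net_commute_iff`). This needs the braiding to be independent of the transporters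
(`twist_eq_twist`) and `ℬ_p(O₁)` to be nonempty (`exists_isometry_localizedIn`). -/

namespace AQFT

/-! ### Order and hulls of regions -/

namespace Region

variable {n : ℕ} {O O₁ O₂ : Region n}

theorem Spacelike.symm (h : O₁.Spacelike O₂) : O₂.Spacelike O₁ := Or.symm h

theorem LeftOf.mono_right (h : O.LeftOf O₂) (h' : O₁.Sub O₂) : O.LeftOf O₁ :=
  fun i => (h i).trans (h' i).1

theorem LeftOf.mono_left (h : O₂.LeftOf O) (h' : O₁.Sub O₂) : O₁.LeftOf O :=
  fun i => (h' i).2.trans (h i)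

theorem Spacelike.mono_right (h : O.Spacelike O₂) (h' : O₁.Sub O₂) : O.Spacelike O₁ :=
  h.imp (fun h => h.mono_right h') (fun h => h.mono_left h')

/-- The smallest region containing two given regions. -/
def hull (O₁ O₂ : Region n) : Region n where
  lo i := min (O₁.lo i) (O₂.lo i)
  hi i := max (O₁.hi i) (O₂.hi i)
  lt i := (min_le_left _ _).trans_lt ((O₁.lt i).trans_le (le_max_left _ _))

theorem sub_hull_left (O₁ O₂ : Region n) : O₁.Sub (O₁.hull O₂) :=
  fun _ => ⟨min_le_left _ _, le_max_left _ _⟩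

theorem sub_hull_right (O₁ O₂ : Region n) : O₂.Sub (O₁.hull O₂) :=
  fun _ => ⟨min_le_right _ _, le_max_right _ _⟩

theorem leftOf_hull (h₁ : O.LeftOf O₁) (h₂ : O.LeftOf O₂) : O.LeftOf (O₁.hull O₂) :=
  fun i => le_min (h₁ i) (h₂ i)

theorem hull_leftOf (h₁ : O₁.LeftOf O) (h₂ : O₂.LeftOf O) : (O₁.hull O₂).LeftOf O :=
  fun i => max_le (h₁ i) (h₂ i)

theorem exists_leftOf (O : Region n) : ∃ O' : Region n, O.LeftOf O' :=
  ⟨⟨O.hi, fun i => O.hi i + 1, fun _ => lt_add_one _⟩, fun _ => le_rfl⟩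

end Region

variable {n : ℕ} {H : Type*} [NormedAddCommGroup H] [InnerProductSpace ℂ H] [CompleteSpace H]

/-! ### Haag duality inside the quasi-local algebra -/

namespace Net

variable (A : Net n H) {O O₁ O₂ : Region n}

theorem mem_quasi_of_mem_alg {a : H →L[ℂ] H} (ha : a ∈ A.alg O) : a ∈ A.quasi :=
  StarSubalgebra.le_topologicalClosure _
    (le_iSup (fun O : Region n => (A.alg O).toStarSubalgebra) O ha)

theorem mem_loc_iff {z : A.quasi} :
    z ∈ A.loc O ↔ ∀ O₁ : Region n, O₁.Spacelike O → ∀ a ∈ A.loc O₁, a * z = z * a := by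
  have h : z ∈ A.loc O ↔ (z : H →L[ℂ] H) ∈ (A.alg O : Set (H →L[ℂ] H)) := Iff.rfl
  rw [h, A.haag_duality O, Set.mem_centralizer_iff]
  constructor
  · intro h O₁ hO a ha
    exact Subtype.ext (h a ⟨O₁, hO, ha⟩)
  · rintro h a ⟨O₁, hO, ha⟩
    exact congrArg Subtype.val (h O₁ hO ⟨a, A.mem_quasi_of_mem_alg ha⟩ ha)

theorem loc_commute (h : O₁.Spacelike O₂) {a b : A.quasi} (ha : a ∈ A.loc O₁)
    (hb : b ∈ A.loc O₂) : a * b = b * a :=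
  A.mem_loc_iff.1 hb O₁ h a ha

theorem one_mem_loc : (1 : A.quasi) ∈ A.loc O := one_mem (A.alg O)

theorem star_mem_loc {a : A.quasi} (ha : a ∈ A.loc O) : star a ∈ A.loc O :=
  star_mem (S := VonNeumannAlgebra H) ha

theorem exists_isometry {e : A.quasi} (he : e ∈ A.loc O) (hp : IsStarProjection e) (h0 : e ≠ 0) :
    ∃ s ∈ A.loc O, star s * s = 1 ∧ s * star s = e := by
  have hp' : IsStarProjection (e : H →L[ℂ] H) :=
    ⟨congrArg Subtype.val hp.isIdempotentElem, congrArg Subtype.val hp.isSelfAdjoint⟩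
  obtain ⟨s, hs, h₁, h₂⟩ := (A.typeIII O).equiv_one e he hp' fun h => h0 (Subtype.ext h)
  exact ⟨⟨s, A.mem_quasi_of_mem_alg hs⟩, hs, Subtype.ext h₁, Subtype.ext h₂⟩

end Net

/-! ### Charge transporters and independence of the braiding -/

namespace DHREnd

variable {A : Net n H} {ρ σ : DHREnd A} {O O₁ O₂ : Region n}

/-- `t` intertwines the restriction of `ρ` to the causal complement of `O` with the identity. -/
def Trivializes (ρ : DHREnd A) (t : A.quasi) (O : Region n) : Prop :=
  ∀ O₁ : Region n, O₁.Spacelike O → ∀ a ∈ A.loc O₁, t * ρ a = a * t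

theorem Transports.trivializes {u : A.quasi} (h : ρ.Transports u O) : ρ.Trivializes u O := by
  intro O₁ hO a ha
  have h' : u * ρ a * star u = a := h.2 O₁ hO a ha
  calc u * ρ a = u * ρ a * (star u * u) := by rw [Unitary.star_mul_self_of_mem h.1, mul_one]
    _ = a * u := by rw [← mul_assoc, h']

theorem trivializes_of_isometry {s : A.quasi} (hs : star s * s = 1)
    (hp : ∀ a, s * star s * ρ a = ρ a * (s * star s))
    (h : A.LocalizedIn (fun c => star s * ρ c * s) O) : ρ.Trivializes (star s) O := by
  intro O₁ hO a ha
  have h' : star s * ρ a * s = a := h O₁ hO a ha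
  calc star s * ρ a = star s * s * star s * ρ a := by rw [hs, one_mul]
    _ = star s * (s * star s * ρ a) := by simp only [mul_assoc]
    _ = star s * ρ a * s * star s := by rw [hp]; simp only [mul_assoc]
    _ = a * star s := by rw [h']

theorem Trivializes.mono {t : A.quasi} (h : ρ.Trivializes t O₁) (hO : O₁.Sub O₂) :
    ρ.Trivializes t O₂ :=
  fun O' h' => h O' (h'.mono_right hO)

theorem Trivializes.map_mul_star {t : A.quasi} (h : ρ.Trivializes t O) (hO : O₁.Spacelike O)
    {a : A.quasi} (ha : a ∈ A.loc O₁) : ρ a * star t = star t * a := by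
  have h' := congrArg star (h O₁ hO (star a) (A.star_mem_loc ha))
  simpa [← map_star] using h'

/-- Outside `O` the factor `star t` turns `a` into `ρ a` and `t'` turns it back, so the product
commutes with the complement and Haag duality applies. -/
theorem Trivializes.mul_star_mem_loc {t t' : A.quasi} (h : ρ.Trivializes t O)
    (h' : ρ.Trivializes t' O) : t' * star t ∈ A.loc O := by
  refine A.mem_loc_iff.2 fun O₁ hO a ha => ?_
  rw [← mul_assoc, ← h' O₁ hO a ha, mul_assoc, h.map_mul_star hO ha, mul_assoc]

/-- The operator `σ(u*) u'* u ρ(u')` for arbitrary `u` and `u'`. -/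
noncomputable def twist (ρ σ : DHREnd A) (u u' : A.quasi) : A.quasi := σ (star u) * star u' * u * ρ u'

/-- Taking adjoints exchanges the two charges, hence which of them sits on the left; this is how
`ε*` enters right-locality. -/
theorem star_twist (u u' : A.quasi) : star (ρ.twist σ u u') = σ.twist ρ u' u := by
  simp [twist, ← map_star, mul_assoc]

/-- Exchange of a charge transporter with an isometry trivializing `ρ` in the spacelike
complement. -/
theorem map_mul_star_mul_star_mul {s r u : A.quasi} (hr : r ∈ unitary A.quasi)
    (hs : ρ.Trivializes (star s) O₁) (hr' : ρ.Trivializes r O₁) (hu : σ.Trivializes u O₂)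
    (hO : O₁.Spacelike O₂) :
    σ s * star u * star s = σ (star r) * star u * r * (s * star s) := by
  -- The net charge of `r * s` is zero, so it is local in `O₁`, where `star u` intertwines the
  -- identity with `σ`.
  have hm : r * s ∈ A.loc O₁ := by simpa using hs.mul_star_mem_loc hr'
  have h := hu.map_mul_star hO hm
  have hr₁ := Unitary.star_mul_self_of_mem hr
  have hσ : σ (star r) * σ (r * s) = σ s := by
    rw [← map_mul, ← mul_assoc, hr₁, one_mul]
  calc σ s * star u * star s = σ (star r) * (σ (r * s) * star u) * star s := by
        rw [← mul_assoc, hσ]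
    _ = σ (star r) * star u * r * (s * star s) := by rw [h]; simp only [mul_assoc]

theorem twist_eq_of_left {u v u' : A.quasi} (hu : u ∈ unitary A.quasi)
    (hv : v ∈ unitary A.quasi) (hut : ρ.Trivializes u O₁) (hvt : ρ.Trivializes v O₁)
    (hu't : σ.Trivializes u' O₂) (hO : O₁.Spacelike O₂) :
    ρ.twist σ u u' = ρ.twist σ v u' := by
  have h := map_mul_star_mul_star_mul (s := star v) hu (by simpa using hvt) hut hu't hO
  rw [star_star, Unitary.star_mul_self_of_mem hv, mul_one] at h
  simp only [twist, h]

theorem twist_eq_of_right {u u' v' : A.quasi} (hu' : u' ∈ unitary A.quasi)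
    (hv' : v' ∈ unitary A.quasi) (hut : ρ.Trivializes u O₁) (hut' : σ.Trivializes u' O₂)
    (hvt' : σ.Trivializes v' O₂) (hO : O₁.Spacelike O₂) :
    ρ.twist σ u u' = ρ.twist σ u v' := by
  rw [← star_twist, twist_eq_of_left hu' hv' hut' hvt' hut hO.symm, star_twist]

/-- The two pairs of regions may overlap, so the change is made in three moves. Each move alters one
transporter while the hull of its old and new regions stays on the correct side of the other charge:
`ρ` goes to an `O` right of both `Oσ` and `Oσ'`, then `σ` moves, then `ρ` returns. -/
theorem twist_eq_twist {u v u' v' : A.quasi} {Oρ Oσ Oρ' Oσ' : Region n} (hO : Oσ.LeftOf Oρ)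
    (hO' : Oσ'.LeftOf Oρ') (hu : ρ.Transports u Oρ) (hu' : σ.Transports u' Oσ)
    (hv : ρ.Transports v Oρ') (hv' : σ.Transports v' Oσ') :
    ρ.twist σ u u' = ρ.twist σ v v' := by
  obtain ⟨O, h⟩ := (Oσ.hull Oσ').exists_leftOf
  obtain ⟨t, ht⟩ : ∃ t, ρ.Transports t O := ρ.transportable O
  have hσ := h.mono_left (Oσ.sub_hull_left Oσ')
  have hσ' := h.mono_left (Oσ.sub_hull_right Oσ')
  calc ρ.twist σ u u' = ρ.twist σ t u' :=
        twist_eq_of_left hu.1 ht.1 (hu.trivializes.mono (Oρ.sub_hull_left O))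
          (ht.trivializes.mono (Oρ.sub_hull_right O)) hu'.trivializes
          (Or.inr (Region.leftOf_hull hO hσ))
    _ = ρ.twist σ t v' :=
        twist_eq_of_right hu'.1 hv'.1 ht.trivializes
          (hu'.trivializes.mono (Oσ.sub_hull_left Oσ'))
          (hv'.trivializes.mono (Oσ.sub_hull_right Oσ')) (Or.inr h)
    _ = ρ.twist σ v v' :=
        twist_eq_of_left ht.1 hv.1 (ht.trivializes.mono (O.sub_hull_left Oρ'))
          (hv.trivializes.mono (O.sub_hull_right Oρ')) hv'.trivializes
          (Or.inr (Region.leftOf_hull hσ' hO'))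

/-- The braiding does not depend on the choice of the auxiliary charge transporters. -/
theorem braiding_eq_twist {u u' : A.quasi} (hO : O₂.LeftOf O₁) (hu : ρ.Transports u O₁)
    (hu' : σ.Transports u' O₂) : ρ.braiding σ = ρ.twist σ u u' := by
  obtain ⟨Oρ, Oσ, h, hρ, hσ⟩ := (exists_auxiliaries ρ σ).choose_spec
  exact twist_eq_twist h hO hρ hσ hu hu'

/-- Every nonzero projection commuting with the image of `ρ` is the range projection of an
isometry onto a subobject localized in a prescribed region. -/
theorem exists_isometry_localizedIn {p : A.quasi} (hp : IsStarProjection p) (h0 : p ≠ 0)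
    (hint : ∀ a, p * ρ a = ρ a * p) (O : Region n) :
    ∃ s : A.quasi, star s * s = 1 ∧ s * star s = p ∧
      A.LocalizedIn (fun c => star s * ρ c * s) O := by
  obtain ⟨u, hu⟩ : ∃ u, ρ.Transports u O := ρ.transportable O
  have hu₁ := Unitary.star_mul_self_of_mem hu.1
  have hu₂ := Unitary.mul_star_self_of_mem hu.1
  have hpp : p * p = p := hp.isIdempotentElem
  have hps : star p = p := hp.isSelfAdjoint
  have ht : ρ.Trivializes (u * p) O := fun O₁ hO a ha => by
    rw [mul_assoc, hint, ← mul_assoc, hu.trivializes O₁ hO a ha, mul_assoc]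
  -- Conjugation by the transporter makes the projection local, so the type III property yields a
  -- local isometry `m`; pulling it back gives `s = star u * m`.
  have he : u * p * star u ∈ A.loc O := hu.trivializes.mul_star_mem_loc ht
  have hconj : star u * (u * p * star u) * u = p := by
    calc star u * (u * p * star u) * u = (star u * u) * p * (star u * u) := by
          simp only [mul_assoc]
      _ = p := by rw [hu₁, one_mul, mul_one]
  have hidem : u * p * star u * (u * p * star u) = u * p * star u := by
    calc u * p * star u * (u * p * star u) = u * p * (star u * u) * p * star u := by
          simp only [mul_assoc]
      _ = u * p * star u := by rw [hu₁, mul_one, mul_assoc u, hpp]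
  have hproj : IsStarProjection (u * p * star u) :=
    ⟨hidem, by simp [IsSelfAdjoint, hps, mul_assoc]⟩
  obtain ⟨m, hm, hm₁, hm₂⟩ := A.exists_isometry he hproj fun h => h0 <| by
    rw [← hconj, h, mul_zero, zero_mul]
  refine ⟨star u * m, ?_, ?_, fun O₁ hO a ha => ?_⟩
  · rw [star_mul, star_star, mul_assoc, ← mul_assoc u, hu₂, one_mul, hm₁]
  · rw [star_mul, star_star, ← hconj, ← hm₂]
    simp only [mul_assoc]
  · calc star (star u * m) * ρ a * (star u * m) = star m * (u * ρ a * star u) * m := by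
          rw [star_mul, star_star]; simp only [mul_assoc]
      _ = star m * (a * m) := by rw [show u * ρ a * star u = a from hu.2 O₁ hO a ha, mul_assoc]
      _ = a := by rw [A.loc_commute hO ha hm, ← mul_assoc, hm₁, one_mul]

end DHREnd

/-! ### Exchange relations and relative locality in the extension -/

namespace Ext

variable {A : Net n H} {Q : QSystem A} {O O₁ O₂ : Region n}

theorem ι_mul_ι_mul_v (a b : A.quasi) : ι Q a * (ι Q b * v Q) = ⟨a * b⟩ := by
  rw [← mul_assoc, ← map_mul]
  exact (eq_ι_mul_v ⟨a * b⟩).symm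

/-- Local elements with trivializing coefficients commute if and only if their charged parts do. -/
theorem commute_of_trivializes {a b s t : A.quasi} (hO : O₁.Spacelike O₂) (ha : a ∈ A.loc O₁)
    (hb : b ∈ A.loc O₂) (hs : Q.θ.Trivializes s O₁) (ht : Q.θ.Trivializes t O₂)
    (h : s * Q.θ t * Q.x = t * Q.θ s * Q.x) :
    Commute (⟨a * s⟩ : Ext Q) ⟨b * t⟩ := by
  ext1
  have h₁ := hs O₂ hO.symm b hb
  have h₂ := ht O₁ hO a ha
  simp only [coeff_mul, map_mul]
  calc a * s * (Q.θ b * Q.θ t) * Q.x = a * (s * Q.θ b) * Q.θ t * Q.x := by simp only [mul_assoc]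
    _ = a * b * (s * Q.θ t * Q.x) := by rw [h₁]; simp only [mul_assoc]
    _ = b * (a * t) * Q.θ s * Q.x := by
        rw [h, A.loc_commute hO ha hb]; simp only [mul_assoc]
    _ = b * t * (Q.θ a * Q.θ s) * Q.x := by rw [← h₂]; simp only [mul_assoc]

/-- The exchange relation of the charged generators with coefficients `u` and `s*`, in terms of
the twist. -/
theorem exchange_iff {p s r u : A.quasi} (hp : Q.IsIntermediate p) (hs₁ : star s * s = 1)
    (hs₂ : s * star s = p) (hs : Q.θ.Trivializes (star s) O₁) (hr : Q.θ.Transports r O₁)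
    (hu : Q.θ.Transports u O₂) (hO : O₁.Spacelike O₂) :
    u * Q.θ (star s) * Q.x = star s * Q.θ u * Q.x ↔
      Q.θ p * Q.x = Q.θ.twist Q.θ r u * (p * Q.x) := by
  have hu₁ := Unitary.star_mul_self_of_mem hu.1
  have hu₂ := Unitary.mul_star_self_of_mem hu.1
  have key : Q.θ.twist Q.θ r u * (p * Q.x) =
      Q.θ s * star u * (star s * Q.θ u * Q.x) := by
    calc Q.θ.twist Q.θ r u * (p * Q.x)
        = Q.θ (star r) * star u * r * (Q.θ u * p) * Q.x := by
          simp only [DHREnd.twist, mul_assoc]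
      _ = Q.θ (star r) * star u * r * (s * star s) * Q.θ u * Q.x := by
          rw [← hp.intertwines, hs₂]; simp only [mul_assoc]
      _ = Q.θ s * star u * (star s * Q.θ u * Q.x) := by
          rw [← DHREnd.map_mul_star_mul_star_mul hr.1 hs hr.trivializes hu.trivializes hO]
          simp only [mul_assoc]
  rw [key]
  constructor
  · intro h
    rw [← h]
    calc Q.θ p * Q.x = Q.θ s * Q.θ (star s) * Q.x := by rw [← hs₂, map_mul]
      _ = Q.θ s * (star u * u) * Q.θ (star s) * Q.x := by rw [hu₁, mul_one]
      _ = _ := by simp only [mul_assoc]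
  · intro h
    -- `θ(s) u*` is only an isometry; multiplying by `u θ(s*)` still inverts the previous step
    -- because `s* = s* p`.
    have hθ : Q.θ (star s) * Q.θ s = 1 := by rw [← map_mul, hs₁, map_one]
    calc u * Q.θ (star s) * Q.x = u * Q.θ (star s * p) * Q.x := by
          rw [← hs₂, ← mul_assoc, hs₁, one_mul]
      _ = u * Q.θ (star s) * (Q.θ p * Q.x) := by rw [map_mul]; simp only [mul_assoc]
      _ = u * (Q.θ (star s) * Q.θ s) * star u * (star s * Q.θ u * Q.x) := by
          rw [h]; simp only [mul_assoc]
      _ = star s * Q.θ u * Q.x := by rw [hθ, mul_one, hu₂, one_mul]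

theorem ne_zero_of_isIntermediate [Nontrivial A.quasi] {p : A.quasi} (hp : Q.IsIntermediate p) :
    p ≠ 0 := by
  rintro rfl
  have hw : Q.w = 0 := by rw [← hp.unit, zero_mul]
  have h := Q.unit_left
  rw [hw, star_zero, zero_mul] at h
  exact zero_ne_one h

/-- Commutation of `ℬ(O₂)` with `ℬ_p(O₁)` for spacelike regions, in terms of the twist. -/
theorem net_commute_iff {p r u : A.quasi} (hp : Q.IsIntermediate p) (hO : O₁.Spacelike O₂)
    (hr : Q.θ.Transports r O₁) (hu : Q.θ.Transports u O₂)
    (htwist : ∀ u', Q.θ.Transports u' O₂ → Q.θ.twist Q.θ r u' = Q.θ.twist Q.θ r u) :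
    (∀ b₁ ∈ intermediateNet Q p O₁, ∀ b₂ ∈ net Q O₂, Commute b₁ b₂) ↔
      Q.θ p * Q.x = Q.θ.twist Q.θ r u * (p * Q.x) := by
  constructor
  · intro h
    -- Outside the zero algebra, `w* x = 1` and `p w = w` force `p ≠ 0`, so there is an isometry
    -- with range `p`.
    cases subsingleton_or_nontrivial A.quasi
    · exact Subsingleton.elim _ _
    obtain ⟨s, hs₁, hs₂, hs⟩ := DHREnd.exists_isometry_localizedIn hp.projection
      (ne_zero_of_isIntermediate hp) hp.intertwines O₁
    have hst := DHREnd.trivializes_of_isometry hs₁ (by rw [hs₂]; exact hp.intertwines) hs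
    rw [← exchange_iff hp hs₁ hs₂ hst hr hu hO]
    -- Unit local factors isolate the exchange relation of the charged generators.
    have hc := h _ ⟨1, A.one_mem_loc, s, hs₁, hs₂, hs, rfl⟩ _ ⟨1, A.one_mem_loc, u, hu, rfl⟩
    have hc' := congrArg coeff hc.eq
    simp only [ι_mul_ι_mul_v, one_mul, coeff_mul] at hc'
    exact hc'.symm
  · rintro h _ ⟨a, ha, s, hs₁, hs₂, hs, rfl⟩ _ ⟨b, hb, u', hu', rfl⟩
    have hst := DHREnd.trivializes_of_isometry hs₁ (by rw [hs₂]; exact hp.intertwines) hs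
    rw [← htwist u' hu', ← exchange_iff hp hs₁ hs₂ hst hr hu' hO] at h
    rw [ι_mul_ι_mul_v, ι_mul_ι_mul_v]
    exact commute_of_trivializes hO ha hb hst hu'.trivializes h.symm

theorem leftLocal_net_iff {p : A.quasi} (hp : Q.IsIntermediate p) :
    LeftLocal (net Q) (intermediateNet Q p) ↔
      Q.θ p * Q.x = Q.θ.braiding Q.θ * (p * Q.x) := by
  have key : ∀ O₁ O₂ : Region n, O₁.LeftOf O₂ →
      ((∀ b₂ ∈ intermediateNet Q p O₂, ∀ b₁ ∈ net Q O₁, Commute b₂ b₁) ↔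
        Q.θ p * Q.x = Q.θ.braiding Q.θ * (p * Q.x)) := fun O₁ O₂ hO => by
    obtain ⟨u, hu⟩ : ∃ u, Q.θ.Transports u O₁ := Q.θ.transportable O₁
    obtain ⟨r, hr⟩ : ∃ r, Q.θ.Transports r O₂ := Q.θ.transportable O₂
    -- The charge `u` of `ℬ` lies left of the charge `r` of `ℬ_p`, which is the order defining the
    -- braiding.
    rw [DHREnd.braiding_eq_twist hO hr hu]
    exact net_commute_iff hp (Or.inr hO) hr hu
      fun u' hu' => DHREnd.twist_eq_twist hO hO hr hu' hr hu
  constructor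
  · intro h
    have hO : (DHREnd.unitRegion n 0).LeftOf (DHREnd.unitRegion n 1) :=
      fun _ => by simp [DHREnd.unitRegion]
    exact (key _ _ hO).1 fun b₂ h₂ b₁ h₁ => (h _ _ hO b₁ h₁ b₂ h₂).symm
  · exact fun h O₁ O₂ hO b₁ h₁ b₂ h₂ => ((key _ _ hO).2 h b₂ h₂ b₁ h₁).symm

theorem rightLocal_net_iff {p : A.quasi} (hp : Q.IsIntermediate p) :
    RightLocal (net Q) (intermediateNet Q p) ↔
      Q.θ p * Q.x = star (Q.θ.braiding Q.θ) * (p * Q.x) := by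
  have key : ∀ O₁ O₂ : Region n, O₁.LeftOf O₂ →
      ((∀ b₁ ∈ intermediateNet Q p O₁, ∀ b₂ ∈ net Q O₂, Commute b₁ b₂) ↔
        Q.θ p * Q.x = star (Q.θ.braiding Q.θ) * (p * Q.x)) := fun O₁ O₂ hO => by
    obtain ⟨r, hr⟩ : ∃ r, Q.θ.Transports r O₁ := Q.θ.transportable O₁
    obtain ⟨u, hu⟩ : ∃ u, Q.θ.Transports u O₂ := Q.θ.transportable O₂
    -- Now `r` lies left of `u`, so the twist of `r` and `u` is the adjoint of the braiding.
    rw [DHREnd.braiding_eq_twist hO hu hr, DHREnd.star_twist]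
    refine net_commute_iff hp (Or.inl hO) hr hu fun u' hu' => ?_
    rw [← DHREnd.star_twist, DHREnd.twist_eq_twist hO hO hu' hr hu hr, DHREnd.star_twist]
  constructor
  · intro h
    have hO : (DHREnd.unitRegion n 0).LeftOf (DHREnd.unitRegion n 1) :=
      fun _ => by simp [DHREnd.unitRegion]
    exact (key _ _ hO).1 (h _ _ hO)
  · exact fun h O₁ O₂ hO => (key _ _ hO).2 h

end Ext

end AQFT

theorem lemma4p7 {n : ℕ} (hn : n = 1 ∨ n = 2)
    {H : Type*} [NormedAddCommGroup H] [InnerProductSpace ℂ H] [CompleteSpace H]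
    (A : AQFT.Net n H) (Q : AQFT.QSystem A) (p : A.quasi) (hp : Q.IsIntermediate p) :
    (AQFT.LeftLocal (AQFT.Ext.net Q) (AQFT.Ext.intermediateNet Q p) ↔
      Q.θ p * Q.x = Q.θ.braiding Q.θ * (p * Q.x)) ∧
    (AQFT.RightLocal (AQFT.Ext.net Q) (AQFT.Ext.intermediateNet Q p) ↔
      Q.θ p * Q.x = star (Q.θ.braiding Q.θ) * (p * Q.x)) :=
  ⟨AQFT.Ext.leftLocal_net_iff hp, AQFT.Ext.rightLocal_net_iff hp⟩
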